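/- For a category $\mathcal{E}$, the centre of $\mathcal{E}$ is the group $\mathrm{Aut}(1_{\mathcal{E}})$ of natural automorphisms of its identity functor, and the covariant isotropy group functor $\mathcal{Z}_{\mathcal{E}} : \mathcal{E} \to \mathsf{Group}$ sends an object $X$ to the group of natural automorphisms of the projection functor $X/\mathcal{E} \to \mathcal{E}$; it sends a morphism $f : X \to Y$ to the homomorphism $(\pi_g)_{\mathrm{dom}(g) = X} \mapsto (\pi_{h \circ f})_{\mathrm{dom}(h) = Y}$. Let $(\mathbb{C}, \mathcal{J})$ be an arbitrary small site, i.e. a small category $\mathbb{C}$ with a Grothendieck topology $\mathcal{J}$, and let $\mathsf{ay}\mathbb{C}$ be the full subcategory of $\mathrm{Sh}(\mathbb{C},\mathcal{J})$ on the sheafifications of the representable presheaves. Then: 1. The functor $\mathcal{Z}_{\mathrm{Sh}(\mathbb{C},\mathcal{J})} : \mathrm{Sh}(\mathbb{C},\mathcal{J}) \to \mathsf{Group}$ is constant on $\mathrm{Aut}(1_{\mathsf{ay}\mathbb{C}})$, i.e. it is naturally isomorphic to the constant functor with value $\mathrm{Aut}(1_{\mathsf{ay}\mathbb{C}})$. 2.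 There is a group isomorphism $\mathrm{Aut}(1_{\mathrm{Sh}(\mathbb{C},\mathcal{J})}) \cong \mathrm{Aut}(1_{\mathsf{ay}\mathbb{C}})$. If moreover $(\mathbb{C},\mathcal{J})$ is subcanonical, i.e. every representable presheaf is a sheaf, then $\mathrm{Aut}(1_{\mathrm{Sh}(\mathbb{C},\mathcal{J})}) \cong \mathrm{Aut}(1_{\mathbb{C}})$ as groups. -/

import Mathlib

open CategoryTheory

universe v u

/-- Restriction of extended inner automorphisms along `f : X ⟶ Y`: a natural automorphism `π` of
the projection `X/E ⥤ E` is sent to the natural automorphism of `Y/E ⥤ E` whose component at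
`g : Y ⟶ Z` is the component `π_{g ∘ f}` of `π` at the composite `X ⟶ Y ⟶ Z`. -/
def covariantIsotropyMap {E : Type u} [Category.{v} E] {X Y : E} (f : X ⟶ Y) :
    Aut (Under.forget X) →* Aut (Under.forget Y) where
  toFun π := NatIso.ofComponents (fun A => π.app ((Under.map f).obj A))
    (fun {_ _} h => π.hom.naturality ((Under.map f).map h))
  map_one' := by
    apply Iso.ext
    ext A
    rfl
  map_mul' π ρ := by
    apply Iso.ext
    ext A
    rfl

/-- The covariant isotropy group functor of a category `E`: it sends `X` to the group of natural
automorphisms of the projection functor `X/E ⥤ E` from the coslice category under `X`. -/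
def covariantIsotropy (E : Type u) [Category.{v} E] : E ⥤ GrpCat.{max u v} where
  obj X := GrpCat.of (Aut (Under.forget X))
  map f := GrpCat.ofHom (covariantIsotropyMap f)
  map_id X := by
    ext π A
    have h := π.hom.naturality (Under.isoMk (f := (Under.map (𝟙 X)).obj A) (g := A)
      (Iso.refl A.right) (by simp)).hom
    exact (Category.comp_id _).symm.trans (h.symm.trans (Category.id_comp _))
  map_comp {X Y Z} f g := by
    ext π A
    have h := π.hom.naturality (Under.isoMk (f := (Under.map (f ≫ g)).obj A)
      (g := (Under.map f).obj ((Under.map g).obj A)) (Iso.refl A.right) (by simp)).hom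
    exact (Category.comp_id _).symm.trans (h.symm.trans (Category.id_comp _))

/-- The full subcategory `ayC` of `Sh(C, J)` on the sheaves in the image of
`C ⥤ (Cᵒᵖ ⥤ Type u) ⥤ Sh(C, J)`, i.e. on the sheafifications of the representable presheaves. -/
abbrev SheafifiedRepresentables {C : Type u} [SmallCategory C] (J : GrothendieckTopology C) :
    Type (u + 1) :=
  (ObjectProperty.ofObj (yoneda ⋙ presheafToSheaf J (Type u)).obj).FullSubcategory

/-! A sheaf topos is finitary extensive. For π in the isotropy group of X, the component at X → X ⨿
Y maps the freely added summand Y to itself (`exists_isotropy_restriction`); the restrictions to Y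
form an automorphism of the identity that determines π. So isotropy at X is the centre, naturally in
X. Sheafified representables are dense, so the centre can be computed on them; density gives both
uniqueness and existence of extensions (`centreRestriction_bijective`). -/

open Limits

/-! ### Isotropy in finitary extensive categories -/

section Extensive

variable {E : Type u} [Category.{v} E]

/-- A natural automorphism of the identity functor of `E` restricts to each coslice category
of `E`. -/
def centreToIsotropy (X : E) : Aut (𝟭 E) →* Aut (Under.forget X) where
  toFun α := NatIso.ofComponents (fun A => α.app A.right)
    (fun {_ _} h => α.hom.naturality h.right)
  map_one' := by
    apply Iso.ext
    ext A
    rfl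
  map_mul' α β := by
    apply Iso.ext
    ext A
    rfl

/-- The component of a natural automorphism of a coslice projection at a morphism under `X`. -/
def isotropyComponent {X : E} (π : Aut (Under.forget X)) {Y : E} (f : X ⟶ Y) : Y ⟶ Y :=
  π.hom.app (Under.mk f)

instance {X Y : E} (π : Aut (Under.forget X)) (f : X ⟶ Y) : IsIso (isotropyComponent π f) :=
  inferInstanceAs (IsIso (Iso.app (F := Under.forget X) (G := Under.forget X) π (Under.mk f)).hom)

lemma isotropyComponent_naturality {X : E} (π : Aut (Under.forget X)) {Y Z : E} (f : X ⟶ Y)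
    (g : X ⟶ Z) (h : Y ⟶ Z) (w : f ≫ h = g) :
    h ≫ isotropyComponent π g = isotropyComponent π f ≫ h :=
  π.hom.naturality (Under.homMk (U := Under.mk f) (V := Under.mk g) h w)

variable [FinitaryExtensive E]

lemma mono_coprod_inr (X Y : E) : Mono (coprod.inr : Y ⟶ X ⨿ Y) :=
  FinitaryExtensive.mono_inr_of_isColimit (c := BinaryCofan.mk coprod.inl coprod.inr)
    (coprodIsCoprod X Y)

/-- A morphism into a binary coproduct factors through the second summand as soon as its pullback
along the first coprojection is initial. -/
lemma exists_comp_inr_eq {X Y Z : E} (p : Z ⟶ X ⨿ Y)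
    (h : ∀ {U : E} {a : U ⟶ Z} {b : U ⟶ X}, a ≫ p = b ≫ coprod.inl →
      Nonempty (IsInitial U)) :
    ∃ q : Z ⟶ Y, q ≫ coprod.inr = p := by
  obtain ⟨U, a, b, hU⟩ : ∃ (U : E) (a : U ⟶ Z) (b : U ⟶ X), IsPullback a b p coprod.inl :=
    have := HasPullbacksOfInclusions.preservesPullbackInl' p
    ⟨_, _, _, IsPullback.of_hasPullback p coprod.inl⟩
  obtain ⟨V, c, d, hV⟩ : ∃ (V : E) (c : V ⟶ Z) (d : V ⟶ Y), IsPullback c d p coprod.inr :=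
    have := HasPullbacksOfInclusions.hasPullbackInr' p
    ⟨_, _, _, IsPullback.of_hasPullback p coprod.inr⟩
  -- Coproducts are van Kampen, so Z is U ⨿ V; with U initial, V ⟶ Z is invertible.
  obtain ⟨hZ⟩ : Nonempty (IsColimit (BinaryCofan.mk a c)) :=
    ((BinaryCofan.isVanKampen_iff _).mp
      (FinitaryExtensive.van_kampen' _ (coprodIsCoprod X Y)) (BinaryCofan.mk a c) b d p
      hU.w.symm hV.w.symm).mpr ⟨hU, hV⟩
  have : IsIso c := (BinaryCofan.isColimit_iff_isIso_inr (h hU.w).some _).mp ⟨hZ⟩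
  refine ⟨inv c ≫ d, ?_⟩
  rw [Category.assoc, ← hV.w, IsIso.inv_hom_id_assoc]

/-- Every natural automorphism of a coslice projection preserves the free summand `Y` of
`X ⨿ Y`. -/
lemma exists_isotropy_restriction {X : E} (π : Aut (Under.forget X)) (Y : E) :
    ∃ q : Y ⟶ Y, q ≫ coprod.inr =
      (coprod.inr : Y ⟶ X ⨿ Y) ≫ isotropyComponent π (coprod.inl : X ⟶ X ⨿ Y) := by
  apply exists_comp_inr_eq
  intro U a b hab
  let i₀ : X ⟶ X ⨿ Y := coprod.inl
  let e : Y ⟶ X ⨿ Y := coprod.inr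
  let i₁ : X ⨿ Y ⟶ (X ⨿ Y) ⨿ Y := coprod.inl
  let e₂ : Y ⟶ (X ⨿ Y) ⨿ Y := coprod.inr
  -- `i₁` and `i₂` agree on X but send Y to different copies. The part of Y that π sends into X
  -- cannot tell them apart, so it lies in two disjoint summands and is initial.
  let i₂ : X ⨿ Y ⟶ (X ⨿ Y) ⨿ Y := coprod.desc (i₀ ≫ i₁) e₂
  have hi : i₀ ≫ i₂ = i₀ ≫ i₁ := coprod.inl_desc _ _
  have he : e ≫ i₂ = e₂ := coprod.inr_desc _ _
  change a ≫ e ≫ isotropyComponent π i₀ = b ≫ i₀ at hab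
  have key : (a ≫ e) ≫ i₁ = a ≫ e₂ := by
    rw [← cancel_mono (isotropyComponent π (i₀ ≫ i₁)), ← he, Category.assoc, Category.assoc,
      Category.assoc, Category.assoc, isotropyComponent_naturality π i₀ (i₀ ≫ i₁) i₁ rfl,
      isotropyComponent_naturality π i₀ (i₀ ≫ i₁) i₂ hi, reassoc_of% hab, reassoc_of% hab, hi]
  let t := (FinitaryExtensive.isPullback_initial_to_binaryCofan
    (coprodIsCoprod (X ⨿ Y) Y)).lift (a ≫ e) a key
  have : IsIso t := inferInstance
  exact ⟨initialIsInitial.ofIso (asIso t).symm⟩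

/-- The natural endomorphism of the identity functor induced by a natural automorphism of a
coslice projection. -/
lemma exists_centre_hom {X : E} (π : Aut (Under.forget X)) :
    ∃ α : 𝟭 E ⟶ 𝟭 E, ∀ A : Under X, α.app A.right = π.hom.app A := by
  choose q hq using exists_isotropy_restriction π
  refine ⟨{ app := q, naturality := fun Y Z f => ?_ }, fun A => ?_⟩
  · have := mono_coprod_inr X Z
    rw [← cancel_mono (coprod.inr : Z ⟶ X ⨿ Z)]
    have n := isotropyComponent_naturality π (coprod.inl : X ⟶ X ⨿ Y) (coprod.inl : X ⟶ X ⨿ Z)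
      (coprod.map (𝟙 X) f) ((coprod.inl_map _ _).trans (Category.id_comp _))
    have h : (coprod.inr : Y ⟶ X ⨿ Y) ≫ coprod.map (𝟙 X) f = f ≫ coprod.inr := by simp
    change (f ≫ q Z) ≫ coprod.inr = (q Y ≫ f) ≫ coprod.inr
    rw [Category.assoc, Category.assoc, hq, ← h, reassoc_of% hq, ← n, reassoc_of% h]
  -- The map [f, 1] from X ⨿ Y to Y lies under X and retracts `coprod.inr`, so naturality along it
  -- identifies `q Y` with the component of π at f.
  · obtain ⟨⟨⟩, Y, f⟩ := A
    change X ⟶ Y at f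
    have n := isotropyComponent_naturality π (coprod.inl : X ⟶ X ⨿ Y) f (coprod.desc f (𝟙 Y))
      (coprod.inl_desc _ _)
    have := congr((coprod.inr : Y ⟶ X ⨿ Y) ≫ $n)
    rw [← reassoc_of% hq, coprod.inr_desc, coprod.inr_desc_assoc, Category.comp_id] at this
    exact this.symm.trans (Category.id_comp _)

/-- Every Y embeds in X ⨿ Y, which is an object under X. -/
lemma centre_hom_ext (X : E) {α β : 𝟭 E ⟶ 𝟭 E}
    (h : ∀ A : Under X, α.app A.right = β.app A.right) : α = β := by
  ext Y
  have := mono_coprod_inr X Y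
  rw [← cancel_mono (coprod.inr : Y ⟶ X ⨿ Y)]
  have hα := α.naturality (coprod.inr : Y ⟶ X ⨿ Y)
  have hβ := β.naturality (coprod.inr : Y ⟶ X ⨿ Y)
  have hY := h (Under.mk (coprod.inl : X ⟶ X ⨿ Y))
  dsimp at hα hβ hY ⊢
  rw [← hα, ← hβ, hY]

lemma centreToIsotropy_bijective (X : E) : Function.Bijective (centreToIsotropy X) := by
  constructor
  · intro α β h
    apply Iso.ext
    exact centre_hom_ext X fun A => congr($(h).hom.app A)
  · intro π
    obtain ⟨α, hα⟩ := exists_centre_hom π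
    obtain ⟨β, hβ⟩ := exists_centre_hom π⁻¹
    refine ⟨⟨α, β, centre_hom_ext X fun A => ?_, centre_hom_ext X fun A => ?_⟩, ?_⟩
    · rw [NatTrans.comp_app, hα, hβ]
      exact π.hom_inv_id_app A
    · rw [NatTrans.comp_app, hα, hβ]
      exact π.inv_hom_id_app A
    · apply Iso.ext
      ext A
      exact hα A

/-- The covariant isotropy functor of a finitary extensive category is constant on its centre. -/
noncomputable def covariantIsotropyIsoConst :
    covariantIsotropy E ≅ (Functor.const E).obj (GrpCat.of (Aut (𝟭 E))) :=
  (NatIso.ofComponents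
    (fun X => (MulEquiv.ofBijective (centreToIsotropy X) (centreToIsotropy_bijective X)).toGrpIso)
    (fun f => by
      ext α
      apply Iso.ext
      ext A
      rfl)).symm

end Extensive

/-! ### Centres and dense functors -/

section Dense

universe v₁ v₂ v₃ u₁ u₂ u₃

variable {C : Type u₁} [Category.{v₁} C] {D : Type u₂} [Category.{v₂} D]
  {E : Type u₃} [Category.{v₃} E]

/-- Uniqueness half of the canonical colimit presentation of Y; `IsDense.exists_hom` is the
existence half. -/
lemma IsDense.hom_ext (F : C ⥤ E) [F.IsDense] {Y Z : E} {f g : Y ⟶ Z}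
    (h : ∀ (X : C) (x : F.obj X ⟶ Y), x ≫ f = x ≫ g) : f = g :=
  (F.denseAt Y).hom_ext fun j => by
    have := h j.left j.hom
    simp only [Functor.LeftExtension.coconeAt_ι_app]
    exact (Category.assoc _ _ _).trans ((congrArg (𝟙 _ ≫ ·) this).trans
      (Category.assoc _ _ _).symm)

lemma IsDense.exists_hom (F : C ⥤ E) [F.IsDense] {Y Z : E}
    (φ : ∀ X : C, (F.obj X ⟶ Y) → (F.obj X ⟶ Z))
    (hφ : ∀ {X X' : C} (f : X ⟶ X') (x : F.obj X' ⟶ Y), φ X (F.map f ≫ x) = F.map f ≫ φ X' x) :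
    ∃ h : Y ⟶ Z, ∀ (X : C) (x : F.obj X ⟶ Y), x ≫ h = φ X x := by
  let c : Cocone (CostructuredArrow.proj F Y ⋙ F) :=
    { pt := Z
      ι :=
        { app j := φ j.left j.hom
          naturality j k f := (hφ f.left k.hom).symm.trans
            ((congrArg (φ j.left) (CostructuredArrow.w f)).trans (Category.comp_id _).symm) } }
  refine ⟨(F.denseAt Y).desc c, fun X x => ?_⟩
  have := (F.denseAt Y).fac c (CostructuredArrow.mk x)
  refine Eq.trans ?_ this
  exact (congrArg (· ≫ (F.denseAt Y).desc c) (Category.id_comp x)).symm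

/-- Recognition of dense functors by the universal property of the canonical cocones, phrased in
terms of generalised elements. -/
lemma IsDense.of_existsUnique (F : C ⥤ E)
    (H : ∀ {Y Z : E} (φ : ∀ X : C, (F.obj X ⟶ Y) → (F.obj X ⟶ Z)),
      (∀ {X X' : C} (f : X ⟶ X') (x : F.obj X' ⟶ Y), φ X (F.map f ≫ x) = F.map f ≫ φ X' x) →
      ∃! h : Y ⟶ Z, ∀ (X : C) (x : F.obj X ⟶ Y), x ≫ h = φ X x) : F.IsDense where
  isDenseAt Y := by
    choose d hd hu using fun s : Cocone (CostructuredArrow.proj F Y ⋙ F) =>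
      H (fun X x => s.ι.app (CostructuredArrow.mk x)) fun f x =>
        (s.w (CostructuredArrow.homMk (f := CostructuredArrow.mk (F.map f ≫ x))
          (f' := CostructuredArrow.mk x) f rfl)).symm
    exact ⟨{
      desc := d
      fac s j := (congrArg (· ≫ d s) (Category.id_comp j.hom)).trans (hd s j.left j.hom)
      uniq s m hm := hu s m fun X x =>
        (congrArg (· ≫ m) (Category.id_comp x)).symm.trans (hm (CostructuredArrow.mk x)) }⟩

/-- Composing a dense functor with a reflector gives a dense functor. -/
lemma isDense_comp_of_adjunction (G : C ⥤ D) [G.IsDense] {L : D ⥤ E} {R : E ⥤ D} (adj : L ⊣ R)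
    [R.Full] [R.Faithful] : (G ⋙ L).IsDense := by
  refine IsDense.of_existsUnique _ fun {Y Z} φ hφ => ?_
  -- Transpose φ across the adjunction, glue by density of `G`, and lift the result through the
  -- fully faithful `R`.
  obtain ⟨k, hk⟩ := IsDense.exists_hom G (Y := R.obj Y) (Z := R.obj Z)
    (fun X x => adj.homEquiv _ _ (φ X ((adj.homEquiv _ _).symm x))) fun f x => by
      rw [Adjunction.homEquiv_naturality_left_symm]
      exact (congrArg _ (hφ f _)).trans (adj.homEquiv_naturality_left _ _)
  obtain ⟨h, rfl⟩ := R.map_surjective k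
  refine ⟨h, fun X x => ?_, fun h' hh' => R.map_injective (IsDense.hom_ext G fun X x => ?_)⟩
  · apply (adj.homEquiv (G.obj X) Z).injective
    refine (adj.homEquiv_naturality_right x h).trans ((hk X _).trans ?_)
    rw [Equiv.symm_apply_apply]
  · rw [hk, ← hh', ← Equiv.symm_apply_eq, adj.homEquiv_naturality_right_symm]

lemma IsDense.id_hom_ext (F : C ⥤ E) [F.IsDense] {α β : 𝟭 E ⟶ 𝟭 E}
    (h : ∀ X, α.app (F.obj X) = β.app (F.obj X)) : α = β := by
  ext Y
  refine IsDense.hom_ext F fun X p => ?_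
  exact (α.naturality p).trans ((congrArg (· ≫ p) (h X)).trans (β.naturality p).symm)

/-- The component at Y is glued from the family x ↦ τ_X ≫ x, compatible because τ is natural. -/
lemma IsDense.exists_id_hom (F : C ⥤ E) [F.IsDense] (τ : F ⟶ F) :
    ∃ α : 𝟭 E ⟶ 𝟭 E, ∀ X, α.app (F.obj X) = τ.app X := by
  choose d hd using fun Y : E => IsDense.exists_hom F (Y := Y) (fun X x => τ.app X ≫ x)
    fun f x => (τ.naturality_assoc f x).symm
  refine ⟨{ app := d, naturality Y Z f := ?_ }, fun X => ?_⟩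
  · refine IsDense.hom_ext F fun X p => ?_
    dsimp
    rw [← Category.assoc, hd, reassoc_of% hd]
  · simpa using hd _ X (𝟙 (F.obj X))

/-- Restriction of natural automorphisms of the identity along a fully faithful functor. -/
noncomputable def centreRestriction (F : D ⥤ E) [F.Full] [F.Faithful] :
    Aut (𝟭 E) →* Aut (𝟭 D) where
  toFun α := NatIso.ofComponents (fun X => F.preimageIso (α.app (F.obj X)))
    (fun f => F.map_injective (by
      simp only [Functor.id_map, Functor.preimageIso_hom, Functor.map_comp, Functor.map_preimage]
      exact α.hom.naturality (F.map f)))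
  map_one' := by
    apply Iso.ext
    ext X
    exact F.map_injective ((F.map_preimage _).trans (F.map_id X).symm)
  map_mul' α β := by
    apply Iso.ext
    ext X
    apply F.map_injective
    change F.map (F.preimage _) = F.map (F.preimage _ ≫ F.preimage _)
    rw [F.map_comp, F.map_preimage, F.map_preimage, F.map_preimage]
    rfl

lemma map_centreRestriction_hom_app (F : D ⥤ E) [F.Full] [F.Faithful] (α : Aut (𝟭 E)) (X : D) :
    F.map ((centreRestriction F α).hom.app X) = α.hom.app (F.obj X) :=
  F.map_preimage _

lemma centreRestriction_bijective (G : C ⥤ D) [G.EssSurj] (F : D ⥤ E) [F.Full] [F.Faithful]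
    [(G ⋙ F).IsDense] : Function.Bijective (centreRestriction F) := by
  constructor
  · intro α β h
    apply Iso.ext
    refine IsDense.id_hom_ext (G ⋙ F) fun X => ?_
    exact (map_centreRestriction_hom_app F α (G.obj X)).symm.trans
      (congr(F.map ($(h).hom.app (G.obj X))).trans (map_centreRestriction_hom_app F β (G.obj X)))
  · intro τ
    obtain ⟨α, hα⟩ := IsDense.exists_id_hom (G ⋙ F)
      { app X := F.map (τ.hom.app (G.obj X))
        naturality X Y f := by
          simpa using congr(F.map $(τ.hom.naturality (G.map f))) }
    obtain ⟨β, hβ⟩ := IsDense.exists_id_hom (G ⋙ F)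
      { app X := F.map (τ.inv.app (G.obj X))
        naturality X Y f := by
          simpa using congr(F.map $(τ.inv.naturality (G.map f))) }
    refine ⟨⟨α, β, IsDense.id_hom_ext (G ⋙ F) fun X => ?_,
      IsDense.id_hom_ext (G ⋙ F) fun X => ?_⟩, ?_⟩
    · rw [NatTrans.comp_app, hα, hβ]
      exact (F.map_comp _ _).symm.trans
        ((congrArg F.map (τ.hom_inv_id_app (G.obj X))).trans (F.map_id _))
    · rw [NatTrans.comp_app, hα, hβ]
      exact (F.map_comp _ _).symm.trans
        ((congrArg F.map (τ.inv_hom_id_app (G.obj X))).trans (F.map_id _))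
    · apply Iso.ext
      ext Y
      -- Agreement is known only on the image of `G`; naturality transports it along `e`.
      let e := G.objObjPreimageIso Y
      rw [← cancel_epi e.hom]
      refine ((NatTrans.naturality _ e.hom).trans ?_).trans (τ.hom.naturality e.hom).symm
      congr 1
      apply F.map_injective
      exact (map_centreRestriction_hom_app F _ _).trans (hα _)

/-- The centre of a category is the centre of each full subcategory containing the image of a
dense functor, provided that image is essentially all of the subcategory. -/
noncomputable def centreEquivOfDense (G : C ⥤ D) [G.EssSurj] (F : D ⥤ E) [F.Full] [F.Faithful]
    [(G ⋙ F).IsDense] : Aut (𝟭 E) ≃* Aut (𝟭 D) :=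
  MulEquiv.ofBijective (centreRestriction F) (centreRestriction_bijective G F)

end Dense

/-! ### Application to sheaves on a site -/

section Sheaves

variable {C : Type u} [SmallCategory C] (J : GrothendieckTopology C)

instance isDense_yoneda_comp_presheafToSheaf :
    (yoneda ⋙ presheafToSheaf J (Type u)).IsDense :=
  isDense_comp_of_adjunction _ (sheafificationAdjunction J (Type u))

/-- The centre of a Grothendieck topos is the centre of its full subcategory of sheafified
representables. -/
noncomputable def centreSheafEquiv :
    Aut (𝟭 (Sheaf J (Type u))) ≃* Aut (𝟭 (SheafifiedRepresentables J)) :=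
  let P := ObjectProperty.ofObj (yoneda ⋙ presheafToSheaf J (Type u)).obj
  let G : C ⥤ SheafifiedRepresentables J :=
    P.lift (yoneda ⋙ presheafToSheaf J (Type u)) fun X => ObjectProperty.ofObj_apply _ X
  have : G.EssSurj := ⟨by
    rintro ⟨_, ⟨X⟩⟩
    exact ⟨X, ⟨Iso.refl _⟩⟩⟩
  have : (G ⋙ P.ι).IsDense := isDense_yoneda_comp_presheafToSheaf J
  centreEquivOfDense G P.ι

/-- For a subcanonical topology, the Yoneda embedding is isomorphic to the sheafified one. -/
noncomputable def yonedaIsoCompPresheafToSheaf [J.Subcanonical] :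
    J.yoneda ≅ yoneda ⋙ presheafToSheaf J (Type u) :=
  -- The counit is invertible since sheaves form a reflective subcategory.
  (Functor.rightUnitor _).symm ≪≫
    Functor.isoWhiskerLeft J.yoneda (asIso (sheafificationAdjunction J (Type u)).counit).symm

/-- The centre of the topos of sheaves on a subcanonical site is the centre of the site. -/
noncomputable def centreSheafEquivOfSubcanonical [J.Subcanonical] :
    Aut (𝟭 (Sheaf J (Type u))) ≃* Aut (𝟭 C) :=
  have : J.yoneda.IsDense := Functor.IsDense.of_iso (yonedaIsoCompPresheafToSheaf J).symm
  have : J.yoneda.Full := J.yonedaFullyFaithful.full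
  have : J.yoneda.Faithful := J.yonedaFullyFaithful.faithful
  have : (𝟭 C ⋙ J.yoneda).IsDense := inferInstance
  centreEquivOfDense (𝟭 C) J.yoneda

end Sheaves

theorem theorem3p12 {C : Type u} [SmallCategory C] (J : GrothendieckTopology C) :
    -- the covariant isotropy functor is (naturally isomorphic to the functor) constant on
    -- the centre of `ayC`
    Nonempty (covariantIsotropy (Sheaf J (Type u)) ≅
      (Functor.const (Sheaf J (Type u))).obj
        (GrpCat.of (Aut (𝟭 (SheafifiedRepresentables J))))) ∧
    -- the centre of the topos
    Nonempty (Aut (𝟭 (Sheaf J (Type u))) ≃* Aut (𝟭 (SheafifiedRepresentables J))) ∧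
    (J.Subcanonical → Nonempty (Aut (𝟭 (Sheaf J (Type u))) ≃* Aut (𝟭 C))) := by
  exact ⟨⟨covariantIsotropyIsoConst ≪≫ (Functor.const _).mapIso (centreSheafEquiv J).toGrpIso⟩,
    ⟨centreSheafEquiv J⟩, fun _ => ⟨centreSheafEquivOfSubcanonical J⟩⟩
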